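/- Fix $n$ and let $\hat x=(\hat q_1,\dots,\hat q_n,\hat p_1,\dots,\hat p_n)$ be the quadrature operators on $L^2(\mathbb R^n)$, where $\hat q_j$ is multiplication by $x_j$ and $\hat p_j=-i\partial_j$. A density operator $\rho$ on $L^2(\mathbb R^n)$ is a Gaussian state if its characteristic function $\xi\mapsto\operatorname{Tr}\{\rho\,e^{i\xi^T\hat x}\}$, $\xi\in\mathbb R^{2n}$, has the form $\exp(i m^T\xi-\tfrac14\xi^TA\xi)$ for some $m\in\mathbb R^{2n}$ and some real symmetric $2n\times 2n$ matrix $A$. Its mean vector $s_\rho$ and its covariance matrix $V_\rho$ are given by $[s_\rho]_j=\langle\hat x_j\rangle_\rho$ and $[V_\rho]_{j,k}=\langle\{\hat x_j-[s_\rho]_j,\ \hat x_k-[s_\rho]_k\}\rangle_\rho$, where $\{\cdot,\cdot\}$ is the anticommutator and $\langle\cdot\rangle_\rho$ is the expectation in $\rho$. The max-relative entropy is $D_{\max}(\rho\Vert\sigma)=\inf\{\lambda\in\mathbb R:\rho\le e^{\lambda}\sigma\}$, with $\inf\emptyset=+\infty$. **Proposition.** Let $\rho$ and $\sigma$ be $n$-mode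 Gaussian states with covariance matrices $V_\rho$ and $V_\sigma$. If $D_{\max}(\rho\Vert\sigma)<+\infty$, then $V_\sigma-V_\rho\ge 0$, that is, $V_\sigma-V_\rho$ is positive semidefinite. -/

import Mathlib

open MeasureTheory
open scoped InnerProductSpace

noncomputable section

namespace GaussianQuantum

/-- The configuration space `ℝⁿ` of `n` modes. -/
abbrev Config (n : ℕ) : Type := EuclideanSpace ℝ (Fin n)

/-- The Hilbert space `L²(ℝⁿ; ℂ)` of `n` bosonic modes (Schrödinger representation). -/
abbrev ModeSpace (n : ℕ) : Type := Lp ℂ 2 (volume : Measure (Config n))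

/-- Labels of the `2n` quadratures: `Sum.inl j` is the position of mode `j`,
`Sum.inr j` is its momentum. -/
abbrev QuadIndex (n : ℕ) : Type := Fin n ⊕ Fin n

variable {n : ℕ}

/-- The momentum part `b` of a phase-space vector `ξ = (a, b)`, as a vector of `ℝⁿ`. -/
def momentumPart (ξ : QuadIndex n → ℝ) : Config n := WithLp.toLp 2 fun j => ξ (Sum.inr j)

/-- The phase `a · x + (a · b) / 2` for `ξ = (a, b)`. -/
def weylPhase (ξ : QuadIndex n → ℝ) (x : Config n) : ℝ :=
  ∑ j, ξ (Sum.inl j) * x j + (∑ j, ξ (Sum.inl j) * ξ (Sum.inr j)) / 2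

/-- The function `x ↦ exp (i (a · x + a · b / 2)) ψ (x + b)` for `ξ = (a, b)`. -/
def weylFun (ξ : QuadIndex n → ℝ) (ψ : Config n → ℂ) (x : Config n) : ℂ :=
  Complex.exp (Complex.I * (weylPhase ξ x : ℂ)) * ψ (x + momentumPart ξ)

theorem continuous_weylPhase (ξ : QuadIndex n → ℝ) : Continuous (weylPhase ξ) := by
  unfold weylPhase
  fun_prop

theorem norm_weylFun (ξ : QuadIndex n → ℝ) (ψ : Config n → ℂ) (x : Config n) :
    ‖weylFun ξ ψ x‖ = ‖ψ (x + momentumPart ξ)‖ := by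
  rw [weylFun, norm_mul, mul_comm Complex.I, Complex.norm_exp_ofReal_mul_I, one_mul]

theorem memLp_weylFun (ξ : QuadIndex n → ℝ) (ψ : ModeSpace n) :
    MemLp (weylFun ξ ψ) 2 (volume : Measure (Config n)) := by
  have h : MemLp (fun x => ψ (x + momentumPart ξ)) 2 (volume : Measure (Config n)) :=
    (Lp.memLp ψ).comp_measurePreserving (measurePreserving_add_right volume (momentumPart ξ))
  have hc : Continuous fun x : Config n => Complex.exp (Complex.I * (weylPhase ξ x : ℂ)) :=
    Complex.continuous_exp.comp
      (continuous_const.mul (Complex.continuous_ofReal.comp (continuous_weylPhase ξ)))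
  exact h.congr_norm (hc.aestronglyMeasurable.mul h.1)
    (Filter.Eventually.of_forall fun x => (norm_weylFun ξ ψ x).symm)

theorem weylFun_congr (ξ : QuadIndex n → ℝ) {f g : Config n → ℂ} (h : f =ᵐ[volume] g) :
    weylFun ξ f =ᵐ[volume] weylFun ξ g := by
  have h' := (measurePreserving_add_right (volume : Measure (Config n))
    (momentumPart ξ)).quasiMeasurePreserving.ae_eq_comp h
  filter_upwards [h'] with x hx
  simp only [Function.comp_apply] at hx
  simp only [weylFun, hx]

/-- The Weyl (displacement) operator `exp (i ξᵀ x̂) = exp (i (a · q̂ + b · p̂))`, `ξ = (a, b)`, on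
`L²(ℝⁿ)`, where `q̂ⱼ` is multiplication by `xⱼ` and `p̂ⱼ = -i ∂ⱼ`. -/
def weyl (ξ : QuadIndex n → ℝ) : ModeSpace n →ₗᵢ[ℂ] ModeSpace n where
  toFun ψ := (memLp_weylFun ξ ψ).toLp (weylFun ξ ψ)
  map_add' ψ φ := by
    rw [← MemLp.toLp_add (memLp_weylFun ξ ψ) (memLp_weylFun ξ φ)]
    refine MemLp.toLp_congr _ _ ((weylFun_congr ξ (Lp.coeFn_add ψ φ)).trans ?_)
    exact Filter.Eventually.of_forall fun x => by simp [weylFun, mul_add]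
  map_smul' c ψ := by
    rw [RingHom.id_apply, ← MemLp.toLp_const_smul c (memLp_weylFun ξ ψ)]
    refine MemLp.toLp_congr _ _ ((weylFun_congr ξ (Lp.coeFn_smul c ψ)).trans ?_)
    exact Filter.Eventually.of_forall fun x => by simp [weylFun, mul_left_comm]
  norm_map' ψ := by
    change ‖(memLp_weylFun ξ ψ).toLp (weylFun ξ ψ)‖ = ‖ψ‖
    have h1 : eLpNorm (weylFun ξ ψ) 2 (volume : Measure (Config n))
        = eLpNorm (ψ ∘ fun x => x + momentumPart ξ) 2 volume :=
      eLpNorm_congr_norm_ae (Filter.Eventually.of_forall fun x => norm_weylFun ξ ψ x)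
    rw [Lp.norm_toLp, h1, eLpNorm_comp_measurePreserving (Lp.memLp ψ).1
      (measurePreserving_add_right volume (momentumPart ξ)), Lp.norm_def]

/-- `τ` is the trace of `T`: the diagonal of `T` is summable with sum `τ` in every
orthonormal basis. -/
def HasTrace (T : ModeSpace n →L[ℂ] ModeSpace n) (τ : ℂ) : Prop :=
  ∀ (ι : Type) (b : HilbertBasis ι ℂ (ModeSpace n)), HasSum (fun i => ⟪b i, T (b i)⟫_ℂ) τ

/-- Density operators (quantum states): positive operators of unit trace. -/
structure IsDensityOperator (ρ : ModeSpace n →L[ℂ] ModeSpace n) : Prop where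
  isPositive : ρ.IsPositive
  hasTrace_one : HasTrace ρ 1

/-- The square root `T^{1/2}` of a positive bounded operator `T` on a Hilbert space
(the unique positive operator with square `T`). -/
def opSqrt {H : Type} [NormedAddCommGroup H] [InnerProductSpace ℂ H] [CompleteSpace H]
    (T : H →L[ℂ] H) : H →L[ℂ] H := CFC.sqrt T

/-- The one-parameter unitary group `t ↦ exp (i t x̂ⱼ)` applied to `ψ`. -/
def quadFlow (j : QuadIndex n) (ψ : ModeSpace n) (t : ℝ) : ModeSpace n :=
  weyl (Pi.single j t) ψ

/-- The domain of the self-adjoint quadrature operator `x̂ⱼ`, the generator of `exp (i t x̂ⱼ)`. -/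
def quadDomain (j : QuadIndex n) : Set (ModeSpace n) :=
  {ψ | DifferentiableAt ℝ (quadFlow j ψ) 0}

/-- The quadrature operator: `x̂ⱼ ψ = -i (d/dt) exp (i t x̂ⱼ) ψ` at `t = 0`, for `ψ` in its domain.
It is multiplication by the coordinate `xⱼ` for a position label and `-i ∂ⱼ` for a
momentum label. -/
def quad (j : QuadIndex n) (ψ : ModeSpace n) : ModeSpace n :=
  (-Complex.I) • deriv (quadFlow j ψ) 0

/-- The range of `ρ^{1/2}` lies in the domain of every quadrature operator, so that
the operators `x̂ⱼ ρ^{1/2}` are everywhere defined. -/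
def QuadraturesDefined (ρ : ModeSpace n →L[ℂ] ModeSpace n) : Prop :=
  ∀ (j : QuadIndex n) (ψ : ModeSpace n), opSqrt ρ ψ ∈ quadDomain j

/-- `s` is the mean vector of the state `ρ`: `sⱼ = ⟨x̂ⱼ⟩_ρ = Tr (ρ^{1/2} x̂ⱼ ρ^{1/2})`. -/
def IsMeanVector (ρ : ModeSpace n →L[ℂ] ModeSpace n) (s : QuadIndex n → ℝ) : Prop :=
  QuadraturesDefined ρ ∧
  ∀ (j : QuadIndex n) (ι : Type) (b : HilbertBasis ι ℂ (ModeSpace n)),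
    HasSum (fun i => ⟪opSqrt ρ (b i), quad j (opSqrt ρ (b i))⟫_ℂ) (s j : ℂ)

/-- The centred quadrature `x̂ⱼ - sⱼ`. -/
def centredQuad (s : QuadIndex n → ℝ) (j : QuadIndex n) (ψ : ModeSpace n) : ModeSpace n :=
  quad j ψ - (s j : ℂ) • ψ

/-- `V` is the covariance matrix of the state `ρ`:
`V j k = ⟨{x̂ⱼ - sⱼ, x̂ₖ - sₖ}⟩_ρ = Tr (ρ^{1/2} {x̂ⱼ - sⱼ, x̂ₖ - sₖ} ρ^{1/2})` with `s` the mean vector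
of `ρ` and `{·, ·}` the anticommutator, so that the vacuum has `V = 1`. The (symmetric) operator on
the left is moved to the other side of the inner product. -/
def IsCovarianceMatrix (ρ : ModeSpace n →L[ℂ] ModeSpace n)
    (V : Matrix (QuadIndex n) (QuadIndex n) ℝ) : Prop :=
  ∃ s : QuadIndex n → ℝ, IsMeanVector ρ s ∧
    ∀ (j k : QuadIndex n) (ι : Type) (b : HilbertBasis ι ℂ (ModeSpace n)),
      HasSum (fun i =>
        ⟪centredQuad s j (opSqrt ρ (b i)), centredQuad s k (opSqrt ρ (b i))⟫_ℂ
          + ⟪centredQuad s k (opSqrt ρ (b i)), centredQuad s j (opSqrt ρ (b i))⟫_ℂ)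
        (V j k : ℂ)

/-- Gaussian states: density operators whose quantum characteristic function
`ξ ↦ Tr (ρ exp (i ξᵀ x̂))` is Gaussian. -/
structure IsGaussianState (ρ : ModeSpace n →L[ℂ] ModeSpace n) : Prop
    extends IsDensityOperator ρ where
  gaussian : ∃ (m : QuadIndex n → ℝ) (A : Matrix (QuadIndex n) (QuadIndex n) ℝ), A.IsSymm ∧
    ∀ ξ : QuadIndex n → ℝ, HasTrace (ρ ∘L (weyl ξ).toContinuousLinearMap)
      (Complex.exp (Complex.I * (m ⬝ᵥ ξ : ℝ) - (1 / 4 : ℂ) * (ξ ⬝ᵥ A.mulVec ξ : ℝ)))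

/-- The max-relative entropy `D_max(ρ‖σ) = inf {r ∈ ℝ : ρ ≤ e^r σ}` in the Loewner order;
it is `⊤` if there is no such `r`. -/
def maxRelEntropy (ρ σ : ModeSpace n →L[ℂ] ModeSpace n) : EReal :=
  sInf {x : EReal | ∃ r : ℝ, x = (r : EReal) ∧ ρ ≤ (Real.exp r : ℂ) • σ}

end GaussianQuantum

end

/-! If `ρ ≤ c σ`, then `Tr (ρ F²) ≤ c Tr (σ F²)` for every bounded self-adjoint `F`. Fix a direction
`w` and let `F` be a function of `wᵀ x̂`. In a Gaussian state `wᵀ x̂` is distributed as a real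
Gaussian of variance `wᵀ A w / 2`, so the law for `ρ` is dominated by `c` times the law for `σ`.
Comparing moment generating functions at large arguments forces `wᵀ A₁ w ≤ wᵀ A₂ w`
(`dotProduct_mulVec_le`).

No functional calculus for `wᵀ x̂` is needed. The exponential `exp (l x)` is the limit of `(1 + l
sin (x / N))^N`, a trigonometric polynomial, and its value at `wᵀ x̂` is a finite combination of
Weyl operators, whose expectations are values of the characteristic function (`integral_pow_le`,
`tendsto_integral_one_add_sin_pow`).

It remains to identify `A` with the covariance matrix (`covarianceMatrix_eq`). First and second
moments are limits of difference quotients of the characteristic function. Since the quadratures are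
unbounded, the limit is exchanged with the trace by dominated convergence, using
`norm_quadSlope_le`. -/

noncomputable section

namespace GaussianQuantum

open Filter Topology ProbabilityTheory

/-! ### Hilbert–Schmidt operators and cyclicity of the trace -/

section HilbertSchmidt

variable {H : Type} [NormedAddCommGroup H] [InnerProductSpace ℂ H] {ι : Type}

theorem hasSum_norm_inner_sq (b : HilbertBasis ι ℂ H) (x : H) :
    HasSum (fun k => ‖⟪x, b k⟫_ℂ‖ ^ 2) (‖x‖ ^ 2) := by
  convert Complex.hasSum_re (b.hasSum_inner_mul_inner x x) using 1
  · ext k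
    rw [← inner_conj_symm (b k) x, Complex.mul_conj, Complex.ofReal_re, Complex.normSq_eq_norm_sq]
  · rw [inner_self_eq_norm_sq_to_K]; norm_cast

theorem summable_norm_inner_sq_prod (b : HilbertBasis ι ℂ H) (A : H →L[ℂ] H)
    (hA : Summable fun i => ‖A (b i)‖ ^ 2) :
    Summable fun p : ι × ι => ‖⟪A (b p.1), b p.2⟫_ℂ‖ ^ 2 := by
  have h0 : ∀ p : ι × ι, 0 ≤ ‖⟪A (b p.1), b p.2⟫_ℂ‖ ^ 2 := fun p => sq_nonneg _
  refine (summable_prod_of_nonneg h0).2 ⟨fun i => (hasSum_norm_inner_sq b (A (b i))).summable, ?_⟩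
  simpa only [(hasSum_norm_inner_sq b _).tsum_eq] using hA

/-- Fubini for sums. The two orders of summation become the two traces in
`exists_hasSum_inner_and_adjoint`. -/
theorem exists_hasSum_rows_and_columns {F : ι × ι → ℂ} {f g : ι → ℂ} (hF : Summable F)
    (hf : ∀ i, HasSum (fun k => F (i, k)) (f i)) (hg : ∀ k, HasSum (fun i => F (i, k)) (g k)) :
    ∃ τ, HasSum f τ ∧ HasSum g τ := by
  obtain ⟨τ, hτ⟩ := hF
  exact ⟨τ, hτ.prod_fiberwise hf, ((Equiv.prodComm ι ι).hasSum_iff.mpr hτ).prod_fiberwise hg⟩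

theorem summable_inner_mul_inner_prod (b : HilbertBasis ι ℂ H) (A B : H →L[ℂ] H)
    (hA : Summable fun i => ‖A (b i)‖ ^ 2) (hB : Summable fun i => ‖B (b i)‖ ^ 2) :
    Summable fun p : ι × ι => ⟪A (b p.1), b p.2⟫_ℂ * ⟪b p.2, B (b p.1)⟫_ℂ := by
  refine Summable.of_norm_bounded
    ((summable_norm_inner_sq_prod b A hA).add (summable_norm_inner_sq_prod b B hB)) fun p => ?_
  rw [norm_mul, norm_inner_symm (b p.2)]
  have h2 := two_mul_le_add_sq ‖⟪A (b p.1), b p.2⟫_ℂ‖ ‖⟪B (b p.1), b p.2⟫_ℂ‖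
  have h0 := mul_nonneg (norm_nonneg ⟪A (b p.1), b p.2⟫_ℂ) (norm_nonneg ⟪B (b p.1), b p.2⟫_ℂ)
  linarith

variable [CompleteSpace H]

/-- Two Hilbert–Schmidt operators satisfy `Tr (A† B) = Tr (B A†)`. -/
theorem exists_hasSum_inner_and_adjoint (b : HilbertBasis ι ℂ H) (A B : H →L[ℂ] H)
    (hA : Summable fun i => ‖A (b i)‖ ^ 2) (hB : Summable fun i => ‖B (b i)‖ ^ 2) :
    ∃ τ, HasSum (fun i => ⟪A (b i), B (b i)⟫_ℂ) τ ∧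
      HasSum (fun k => ⟪B.adjoint (b k), A.adjoint (b k)⟫_ℂ) τ := by
  refine exists_hasSum_rows_and_columns (summable_inner_mul_inner_prod b A B hA hB)
    (fun i => b.hasSum_inner_mul_inner (A (b i)) (B (b i))) fun k => ?_
  have h := b.hasSum_inner_mul_inner (B.adjoint (b k)) (A.adjoint (b k))
  simp only [ContinuousLinearMap.adjoint_inner_left, ContinuousLinearMap.adjoint_inner_right] at h
  simpa only [mul_comm, ContinuousLinearMap.adjoint_inner_right] using h

theorem summable_norm_adjoint_sq (b : HilbertBasis ι ℂ H) (A : H →L[ℂ] H)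
    (hA : Summable fun i => ‖A (b i)‖ ^ 2) : Summable fun i => ‖A.adjoint (b i)‖ ^ 2 := by
  obtain ⟨τ, -, h⟩ := exists_hasSum_inner_and_adjoint b A A hA hA
  refine (Complex.hasSum_re h).summable.congr fun i => ?_
  rw [inner_self_eq_norm_sq_to_K]; norm_cast

/-- Cyclicity of the trace: `Tr (S S G) = Tr (S G S)` for `S` self-adjoint and Hilbert–Schmidt. -/
theorem hasSum_inner_conj (b : HilbertBasis ι ℂ H) (S G : H →L[ℂ] H) (hS : IsSelfAdjoint S)
    (hs : Summable fun i => ‖S (b i)‖ ^ 2) {τ : ℂ}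
    (h : HasSum (fun i => ⟪b i, S (S (G (b i)))⟫_ℂ) τ) :
    HasSum (fun i => ⟪S (b i), G (S (b i))⟫_ℂ) τ := by
  have hS' : S.adjoint = S := hS
  -- `G† S` is Hilbert–Schmidt because `G†` is bounded; its adjoint is `S G`.
  have hG : Summable fun i => ‖(S ∘L G) (b i)‖ ^ 2 := by
    have : Summable fun i => ‖(G.adjoint ∘L S) (b i)‖ ^ 2 := by
      refine Summable.of_nonneg_of_le (fun i => by positivity) (fun i => ?_)
        (hs.mul_left (‖G.adjoint‖ ^ 2))
      rw [← mul_pow]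
      exact pow_le_pow_left₀ (norm_nonneg _) (G.adjoint.le_opNorm _) 2
    have h2 := summable_norm_adjoint_sq b _ this
    rwa [ContinuousLinearMap.adjoint_comp, ContinuousLinearMap.adjoint_adjoint, hS'] at h2
  obtain ⟨τ', h1, h2⟩ := exists_hasSum_inner_and_adjoint b S (S ∘L G) hs hG
  have e : τ' = τ := by
    refine h1.unique ?_
    convert h using 2 with i
    rw [ContinuousLinearMap.comp_apply, ← ContinuousLinearMap.adjoint_inner_right, hS']
  rw [e] at h2
  convert h2 using 2 with i
  rw [ContinuousLinearMap.adjoint_comp, hS', ContinuousLinearMap.comp_apply,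
    ContinuousLinearMap.adjoint_inner_left]

theorem opSqrt_isSelfAdjoint (T : H →L[ℂ] H) : IsSelfAdjoint (opSqrt T) :=
  IsSelfAdjoint.of_nonneg (CFC.sqrt_nonneg T)

theorem opSqrt_opSqrt {T : H →L[ℂ] H} (hT : T.IsPositive) (x : H) :
    opSqrt T (opSqrt T x) = T x := by
  have h := CFC.sqrt_mul_sqrt_self T ((ContinuousLinearMap.nonneg_iff_isPositive T).mpr hT)
  exact DFunLike.congr_fun h x

theorem inner_opSqrt {T : H →L[ℂ] H} (x y : H) :
    ⟪opSqrt T x, y⟫_ℂ = ⟪x, opSqrt T y⟫_ℂ := by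
  conv_lhs => rw [← (opSqrt_isSelfAdjoint T).adjoint_eq]
  rw [ContinuousLinearMap.adjoint_inner_left]

theorem hasSum_norm_opSqrt_sq {T : H →L[ℂ] H} (hT : T.IsPositive) (b : HilbertBasis ι ℂ H) {τ : ℂ}
    (h : HasSum (fun i => ⟪b i, T (b i)⟫_ℂ) τ) :
    HasSum (fun i => ‖opSqrt T (b i)‖ ^ 2) τ.re := by
  convert Complex.hasSum_re h using 2 with i
  rw [← opSqrt_opSqrt hT, ← inner_opSqrt, inner_self_eq_norm_sq_to_K]; norm_cast

/-- Bridges two forms of the expectation: the characteristic function uses `Tr (T G)`, the moments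
use `Tr (T^{1/2} G T^{1/2})`. -/
theorem hasSum_inner_opSqrt {T : H →L[ℂ] H} (hT : T.IsPositive) (b : HilbertBasis ι ℂ H) {τ₀ : ℂ}
    (h₀ : HasSum (fun i => ⟪b i, T (b i)⟫_ℂ) τ₀) (G : H →L[ℂ] H) {τ : ℂ}
    (h : HasSum (fun i => ⟪b i, T (G (b i))⟫_ℂ) τ) :
    HasSum (fun i => ⟪opSqrt T (b i), G (opSqrt T (b i))⟫_ℂ) τ := by
  refine hasSum_inner_conj b _ G (opSqrt_isSelfAdjoint T) (hasSum_norm_opSqrt_sq hT b h₀).summable ?_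
  simpa only [opSqrt_opSqrt hT] using h

end HilbertSchmidt

/-! ### Weyl relations and the quadratures as generators -/

variable {n : ℕ}

/-- Twice the phase of the Weyl relation. -/
def symplecticForm (ξ η : QuadIndex n → ℝ) : ℝ :=
  ∑ j, (η (Sum.inl j) * ξ (Sum.inr j) - ξ (Sum.inl j) * η (Sum.inr j))

theorem weyl_coeFn (ξ : QuadIndex n → ℝ) (ψ : ModeSpace n) :
    weyl ξ ψ =ᵐ[volume] weylFun ξ ψ :=
  MemLp.coeFn_toLp (memLp_weylFun ξ ψ)

theorem weyl_weyl (ξ η : QuadIndex n → ℝ) (ψ : ModeSpace n) :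
    weyl ξ (weyl η ψ) =
      Complex.exp (Complex.I * ((symplecticForm ξ η / 2 : ℝ) : ℂ)) • weyl (ξ + η) ψ := by
  refine Lp.ext ?_
  filter_upwards [weyl_coeFn ξ (weyl η ψ), weylFun_congr ξ (weyl_coeFn η ψ),
    Lp.coeFn_smul (Complex.exp (Complex.I * ((symplecticForm ξ η / 2 : ℝ) : ℂ))) (weyl (ξ + η) ψ),
    weyl_coeFn (ξ + η) ψ] with x h1 h2 h3 h4
  rw [h1, h2, h3, Pi.smul_apply, h4]
  have e : x + momentumPart ξ + momentumPart η = x + momentumPart (ξ + η) := by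
    rw [add_assoc]; congr 1
  have hph : weylPhase ξ x + weylPhase η (x + momentumPart ξ)
      = symplecticForm ξ η / 2 + weylPhase (ξ + η) x := by
    simp only [weylPhase, symplecticForm, momentumPart, Pi.add_apply, PiLp.add_apply,
      Finset.sum_div, ← Finset.sum_add_distrib]
    refine Finset.sum_congr rfl fun j _ => ?_
    ring
  simp only [weylFun, smul_eq_mul, e, ← mul_assoc, ← Complex.exp_add, ← mul_add, ← Complex.ofReal_add, hph]

theorem weyl_zero (ψ : ModeSpace n) : weyl 0 ψ = ψ := by
  refine Lp.ext ?_
  filter_upwards [weyl_coeFn 0 ψ] with x h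
  have e : momentumPart (0 : QuadIndex n → ℝ) = 0 := rfl
  rw [h, weylFun, e]
  simp [weylPhase]

theorem symplecticForm_smul_smul (s t : ℝ) (w : QuadIndex n → ℝ) :
    symplecticForm (s • w) (t • w) = 0 := by
  refine Finset.sum_eq_zero fun j _ => ?_
  simp only [Pi.smul_apply, smul_eq_mul]; ring

theorem weyl_smul_add (s t : ℝ) (w : QuadIndex n → ℝ) (ψ : ModeSpace n) :
    weyl (s • w) (weyl (t • w) ψ) = weyl ((s + t) • w) ψ := by
  rw [weyl_weyl, symplecticForm_smul_smul, add_smul]; simp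

theorem weyl_neg_weyl (ξ : QuadIndex n → ℝ) (ψ : ModeSpace n) : weyl (-ξ) (weyl ξ ψ) = ψ := by
  have h := weyl_smul_add (-1) 1 ξ ψ
  simpa [weyl_zero] using h

theorem inner_weyl_left (ξ : QuadIndex n → ℝ) (ψ φ : ModeSpace n) :
    ⟪weyl ξ ψ, φ⟫_ℂ = ⟪ψ, weyl (-ξ) φ⟫_ℂ := by
  rw [← (weyl (-ξ)).inner_map_map, weyl_neg_weyl]

theorem single_eq_smul (j : QuadIndex n) (t : ℝ) :
    (Pi.single j t : QuadIndex n → ℝ) = t • Pi.single j 1 := by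
  rw [← Pi.single_smul, smul_eq_mul, mul_one]

theorem quadFlow_zero (j : QuadIndex n) (ψ : ModeSpace n) : quadFlow j ψ 0 = ψ := by
  rw [quadFlow, Pi.single_zero, weyl_zero]

theorem weyl_quadFlow (j : QuadIndex n) (ψ : ModeSpace n) (s t : ℝ) :
    weyl (Pi.single j s) (quadFlow j ψ t) = quadFlow j ψ (s + t) := by
  rw [quadFlow, quadFlow, single_eq_smul j s, single_eq_smul j t, weyl_smul_add, ← single_eq_smul]

theorem hasDerivAt_quadFlow_zero {j : QuadIndex n} {ψ : ModeSpace n} (h : ψ ∈ quadDomain j) :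
    HasDerivAt (quadFlow j ψ) (Complex.I • quad j ψ) 0 := by
  have h' : DifferentiableAt ℝ (quadFlow j ψ) 0 := h
  have e : Complex.I • quad j ψ = deriv (quadFlow j ψ) 0 := by
    rw [show quad j ψ = (-Complex.I) • deriv (quadFlow j ψ) 0 from rfl, smul_smul]
    simp
  rw [e]
  exact h'.hasDerivAt

/-- The group law transports the derivative at `0` to any time `s`. -/
theorem hasDerivAt_quadFlow {j : QuadIndex n} {ψ : ModeSpace n} (h : ψ ∈ quadDomain j) (s : ℝ) :
    HasDerivAt (quadFlow j ψ) (weyl (Pi.single j s) (Complex.I • quad j ψ)) s := by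
  have e : quadFlow j ψ = fun t => weyl (Pi.single j s) (quadFlow j ψ (t - s)) := by
    funext t; rw [weyl_quadFlow, add_sub_cancel]
  have h0 : HasDerivAt (quadFlow j ψ) (Complex.I • quad j ψ) (s - s) := by
    rw [sub_self]; exact hasDerivAt_quadFlow_zero h
  have h1 : HasDerivAt (fun t => quadFlow j ψ (t - s)) (Complex.I • quad j ψ) s :=
    h0.comp_sub_const s s
  have h2 := (((weyl (Pi.single j s)).toContinuousLinearMap.restrictScalars ℝ).hasFDerivAt
    (x := quadFlow j ψ (s - s))).comp_hasDerivAt s h1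
  rw [e]
  exact h2

/-- Mean value inequality: Weyl operators are isometric, so the derivative of the flow has constant
norm `‖quad j ψ‖`. -/
theorem norm_quadFlow_sub_le {j : QuadIndex n} {ψ : ModeSpace n} (h : ψ ∈ quadDomain j) (t : ℝ) :
    ‖quadFlow j ψ t - ψ‖ ≤ ‖quad j ψ‖ * |t| := by
  have := Convex.norm_image_sub_le_of_norm_hasDerivWithin_le (C := ‖quad j ψ‖) (s := Set.univ)
    (fun s _ => (hasDerivAt_quadFlow h s).hasDerivWithinAt)
    (fun s _ => by rw [LinearIsometry.norm_map, norm_smul, Complex.norm_I, one_mul])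
    convex_univ (Set.mem_univ (0 : ℝ)) (Set.mem_univ t)
  simpa [quadFlow_zero] using this

/-- The difference quotient of the one-parameter group of `x̂ⱼ` at `0`. -/
def quadSlope (j : QuadIndex n) (ψ : ModeSpace n) (t : ℝ) : ModeSpace n :=
  ((t⁻¹ : ℝ) : ℂ) • (quadFlow j ψ t - ψ)

/-- Uniformity in `t` makes this the dominating bound in the trace limits below. -/
theorem norm_quadSlope_le {j : QuadIndex n} {ψ : ModeSpace n} (h : ψ ∈ quadDomain j) (t : ℝ) :
    ‖quadSlope j ψ t‖ ≤ ‖quad j ψ‖ := by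
  rw [quadSlope, norm_smul, Complex.norm_real, norm_inv, Real.norm_eq_abs]
  rcases eq_or_ne t 0 with rfl | ht
  · simp
  · rw [inv_mul_le_iff₀ (abs_pos.mpr ht), mul_comm]
    exact norm_quadFlow_sub_le h t

theorem tendsto_quadSlope {j : QuadIndex n} {ψ : ModeSpace n} (h : ψ ∈ quadDomain j) :
    Tendsto (quadSlope j ψ) (𝓝[≠] 0) (𝓝 (Complex.I • quad j ψ)) := by
  have := (hasDerivAt_quadFlow_zero h).tendsto_slope_zero
  simp only [zero_add, quadFlow_zero] at this
  exact this

/-! ### Moments from the characteristic function -/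

/-- The Gaussian characteristic function with parameters `m` and `A`. -/
def gaussianChar (m : QuadIndex n → ℝ) (A : Matrix (QuadIndex n) (QuadIndex n) ℝ)
    (ξ : QuadIndex n → ℝ) : ℂ :=
  Complex.exp (Complex.I * (m ⬝ᵥ ξ : ℝ) - (1 / 4 : ℂ) * (ξ ⬝ᵥ A.mulVec ξ : ℝ))

theorem gaussianChar_zero (m : QuadIndex n → ℝ) (A : Matrix (QuadIndex n) (QuadIndex n) ℝ) :
    gaussianChar m A 0 = 1 := by
  simp [gaussianChar]

theorem gaussianChar_smul (m : QuadIndex n → ℝ) (A : Matrix (QuadIndex n) (QuadIndex n) ℝ)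
    (t : ℝ) (w : QuadIndex n → ℝ) :
    gaussianChar m A (t • w) = Complex.exp
      (Complex.I * (m ⬝ᵥ w : ℝ) * t + (-(1 / 4 : ℂ) * (w ⬝ᵥ A.mulVec w : ℝ)) * t ^ 2) := by
  rw [gaussianChar]
  congr 1
  rw [Matrix.mulVec_smul, smul_dotProduct, dotProduct_smul, dotProduct_smul]
  simp only [smul_eq_mul]
  push_cast
  ring

/-- Second-order Taylor expansion: with `z = α t + β t²`, the remainder after `1 + z + z² / 2` is
`O(t³)`, hence negligible after division by `t²`. -/
theorem tendsto_exp_quadratic (α β : ℂ) :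
    Tendsto (fun t : ℝ => ((t⁻¹ : ℝ) : ℂ) ^ 2 * (Complex.exp (α * t + β * t ^ 2) - 1 - α * t))
      (𝓝[≠] 0) (𝓝 (α ^ 2 / 2 + β)) := by
  have hz : Tendsto (fun t : ℝ => α * t + β * t ^ 2) (𝓝 0) (𝓝 0) := by
    have : Continuous (fun t : ℝ => α * t + β * t ^ 2) := by fun_prop
    simpa using this.tendsto 0
  have hO := (Complex.exp_sub_sum_range_isBigO_pow 3).comp_tendsto hz
  have hz1 : (fun t : ℝ => α * t + β * t ^ 2) =O[𝓝 0] fun t : ℝ => t := by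
    have h1 : (fun t : ℝ => α + β * t) =O[𝓝 0] fun _ : ℝ => (1 : ℝ) := by
      have : Continuous (fun t : ℝ => α + β * t) := by fun_prop
      exact (this.tendsto 0).isBigO_one ℝ
    have h2 : (fun t : ℝ => (t : ℂ)) =O[𝓝 0] fun t : ℝ => t :=
      Asymptotics.IsBigO.of_bound 1 (Eventually.of_forall fun t => by simp)
    refine (h1.mul h2).congr (fun t => by ring) fun t => by ring
  have h3 : (fun t : ℝ => Complex.exp (α * t + β * t ^ 2)
      - ∑ i ∈ Finset.range 3, (α * t + β * t ^ 2) ^ i / (i.factorial : ℂ)) =O[𝓝 0]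
        fun t : ℝ => t ^ 3 := hO.trans (hz1.pow 3)
  have h4 : Tendsto (fun t : ℝ => ((t⁻¹ : ℝ) : ℂ) ^ 2 * (Complex.exp (α * t + β * t ^ 2)
      - ∑ i ∈ Finset.range 3, (α * t + β * t ^ 2) ^ i / (i.factorial : ℂ))) (𝓝[≠] 0) (𝓝 0) := by
    have h5 : (fun t : ℝ => ((t⁻¹ : ℝ) : ℂ) ^ 2) =O[𝓝[≠] 0] fun t : ℝ => (t⁻¹) ^ 2 :=
      Asymptotics.IsBigO.of_bound 1 (Eventually.of_forall fun t => by simp)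
    refine (h5.mul (h3.mono nhdsWithin_le_nhds)).trans_tendsto ?_
    refine (tendsto_id.mono_left nhdsWithin_le_nhds).congr' ?_
    filter_upwards [self_mem_nhdsWithin] with t ht
    have ht' : t ≠ 0 := ht
    simp only [id]
    field_simp
  have h6 : Tendsto (fun t : ℝ => (α + β * t) ^ 2 / 2 + β) (𝓝[≠] 0) (𝓝 (α ^ 2 / 2 + β)) := by
    have : Continuous (fun t : ℝ => (α + β * t) ^ 2 / 2 + β) := by fun_prop
    simpa using (this.tendsto 0).mono_left nhdsWithin_le_nhds
  have h7 := h4.add h6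
  rw [zero_add] at h7
  refine h7.congr' ?_
  filter_upwards [self_mem_nhdsWithin] with t ht
  have ht' : (t : ℂ) ≠ 0 := by exact_mod_cast ht
  simp only [Finset.sum_range_succ, Finset.sum_range_zero, Nat.factorial]
  push_cast
  field_simp
  ring

theorem tendsto_exp_linear (α β : ℂ) :
    Tendsto (fun t : ℝ => ((t⁻¹ : ℝ) : ℂ) * (Complex.exp (α * t + β * t ^ 2) - 1))
      (𝓝[≠] 0) (𝓝 α) := by
  have h1 := tendsto_exp_quadratic α β
  have h2 : Tendsto (fun t : ℝ => (t : ℂ)) (𝓝[≠] 0) (𝓝 0) := by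
    simpa using (Complex.continuous_ofReal.tendsto 0).mono_left nhdsWithin_le_nhds
  have h3 := (h2.mul h1).add_const α
  rw [zero_mul, zero_add] at h3
  refine h3.congr' ?_
  filter_upwards [self_mem_nhdsWithin] with t ht
  have ht' : (t : ℂ) ≠ 0 := by exact_mod_cast ht
  push_cast
  field_simp
  ring

section Family

variable {ι : Type} {ψ : ι → ModeSpace n} {m : QuadIndex n → ℝ}
  {A : Matrix (QuadIndex n) (QuadIndex n) ℝ}

theorem hasSum_inner_self
    (hχ : ∀ ξ, HasSum (fun i => ⟪ψ i, weyl ξ (ψ i)⟫_ℂ) (gaussianChar m A ξ)) :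
    HasSum (fun i => ⟪ψ i, ψ i⟫_ℂ) 1 := by
  simpa only [weyl_zero, gaussianChar_zero] using hχ 0

theorem summable_norm_sq (hχ : ∀ ξ, HasSum (fun i => ⟪ψ i, weyl ξ (ψ i)⟫_ℂ) (gaussianChar m A ξ)) :
    Summable fun i => ‖ψ i‖ ^ 2 := by
  refine (Complex.hasSum_re (hasSum_inner_self hχ)).summable.congr fun i => ?_
  rw [inner_self_eq_norm_sq_to_K]; norm_cast

theorem summable_norm_mul_norm {f g : ι → ModeSpace n} (hf : Summable fun i => ‖f i‖ ^ 2)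
    (hg : Summable fun i => ‖g i‖ ^ 2) : Summable fun i => ‖f i‖ * ‖g i‖ := by
  refine Summable.of_nonneg_of_le (fun i => by positivity) (fun i => ?_) (hf.add hg)
  have h2 := two_mul_le_add_sq ‖f i‖ ‖g i‖
  have h0 := mul_nonneg (norm_nonneg (f i)) (norm_nonneg (g i))
  linarith

theorem tsum_inner_quad (j : QuadIndex n) (hψ : ∀ i, ψ i ∈ quadDomain j)
    (hχ : ∀ ξ, HasSum (fun i => ⟪ψ i, weyl ξ (ψ i)⟫_ℂ) (gaussianChar m A ξ))
    (hq : Summable fun i => ‖quad j (ψ i)‖ ^ 2) :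
    ∑' i, ⟪ψ i, quad j (ψ i)⟫_ℂ = m j := by
  have hlim : Tendsto (fun t => ∑' i, ⟪ψ i, quadSlope j (ψ i) t⟫_ℂ) (𝓝[≠] 0)
      (𝓝 (∑' i, ⟪ψ i, Complex.I • quad j (ψ i)⟫_ℂ)) := by
    refine tendsto_tsum_of_dominated_convergence
      (summable_norm_mul_norm (summable_norm_sq hχ) hq)
      (fun i => tendsto_const_nhds.inner (tendsto_quadSlope (hψ i)))
      (Eventually.of_forall fun t i => ?_)
    exact (norm_inner_le_norm _ _).trans
      (mul_le_mul_of_nonneg_left (norm_quadSlope_le (hψ i) t) (norm_nonneg _))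
  have hval : ∀ t : ℝ, ∑' i, ⟪ψ i, quadSlope j (ψ i) t⟫_ℂ
      = ((t⁻¹ : ℝ) : ℂ) * (gaussianChar m A (t • Pi.single j 1) - 1) := fun t => by
    have h := ((hχ (t • Pi.single j 1)).sub (hasSum_inner_self hχ)).mul_left ((t⁻¹ : ℝ) : ℂ)
    rw [← h.tsum_eq]
    refine tsum_congr fun i => ?_
    rw [quadSlope, inner_smul_right, inner_sub_right, quadFlow, single_eq_smul]
  simp only [hval, gaussianChar_smul] at hlim
  have h := tendsto_nhds_unique hlim (tendsto_exp_linear _ _)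
  simp only [inner_smul_right, tsum_mul_left, dotProduct_single, mul_one] at h
  exact mul_left_cancel₀ Complex.I_ne_zero h

theorem inner_weyl_weyl_smul (t : ℝ) (v w : QuadIndex n → ℝ) (φ : ModeSpace n) :
    ⟪weyl (t • v) φ, weyl (t • w) φ⟫_ℂ =
      Complex.exp (Complex.I * ((symplecticForm (-v) w / 2 : ℝ) : ℂ) * t ^ 2)
        * ⟪φ, weyl (t • (w - v)) φ⟫_ℂ := by
  rw [inner_weyl_left, weyl_weyl, inner_smul_right]
  have e : symplecticForm (-(t • v)) (t • w) = symplecticForm (-v) w * t ^ 2 := by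
    rw [symplecticForm, symplecticForm, Finset.sum_mul]
    refine Finset.sum_congr rfl fun j _ => ?_
    simp only [Pi.neg_apply, Pi.smul_apply, smul_eq_mul]; ring
  rw [e, smul_sub, neg_add_eq_sub]
  congr 2
  push_cast; ring

/-- The product of two difference quotients expands into four Weyl expectations, so the sum is a
mixed second difference of the characteristic function. The imaginary term is the commutator part,
coming from the Weyl phase. -/
theorem tsum_inner_quad_quad (j k : QuadIndex n) (hj : ∀ i, ψ i ∈ quadDomain j)
    (hk : ∀ i, ψ i ∈ quadDomain k)
    (hχ : ∀ ξ, HasSum (fun i => ⟪ψ i, weyl ξ (ψ i)⟫_ℂ) (gaussianChar m A ξ))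
    (hqj : Summable fun i => ‖quad j (ψ i)‖ ^ 2) (hqk : Summable fun i => ‖quad k (ψ i)‖ ^ 2) :
    ∑' i, ⟪quad j (ψ i), quad k (ψ i)⟫_ℂ =
      Complex.I * ((symplecticForm (-Pi.single j 1) (Pi.single k 1) / 2 : ℝ) : ℂ)
        + m j * m k + (A j k + A k j) / 4 := by
  have hlim : Tendsto (fun t => ∑' i, ⟪quadSlope j (ψ i) t, quadSlope k (ψ i) t⟫_ℂ) (𝓝[≠] 0)
      (𝓝 (∑' i, ⟪Complex.I • quad j (ψ i), Complex.I • quad k (ψ i)⟫_ℂ)) := by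
    refine tendsto_tsum_of_dominated_convergence (summable_norm_mul_norm hqj hqk)
      (fun i => (tendsto_quadSlope (hj i)).inner (tendsto_quadSlope (hk i)))
      (Eventually.of_forall fun t i => ?_)
    exact (norm_inner_le_norm _ _).trans
      (mul_le_mul (norm_quadSlope_le (hj i) t) (norm_quadSlope_le (hk i) t)
        (norm_nonneg _) (norm_nonneg _))
  set v : QuadIndex n → ℝ := Pi.single j 1 with hv
  set w : QuadIndex n → ℝ := Pi.single k 1 with hw
  set κ : ℂ := ((symplecticForm (-v) w / 2 : ℝ) : ℂ) with hκ
  have hval : ∀ t : ℝ, ∑' i, ⟪quadSlope j (ψ i) t, quadSlope k (ψ i) t⟫_ℂ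
      = ((t⁻¹ : ℝ) : ℂ) ^ 2 * (Complex.exp (Complex.I * κ * t ^ 2)
          * gaussianChar m A (t • (w - v)) - gaussianChar m A (t • (-v))
          - gaussianChar m A (t • w) + 1) := fun t => by
    have h := (((((hχ (t • (w - v))).mul_left (Complex.exp (Complex.I * κ * t ^ 2))).sub
      (hχ (t • (-v)))).sub (hχ (t • w))).add (hasSum_inner_self hχ)).mul_left
        (((t⁻¹ : ℝ) : ℂ) ^ 2)
    rw [← h.tsum_eq]
    refine tsum_congr fun i => ?_
    rw [quadSlope, quadSlope, inner_smul_left, inner_smul_right, inner_sub_left, inner_sub_right,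
      inner_sub_right, quadFlow, quadFlow, single_eq_smul j, single_eq_smul k, ← hv, ← hw,
      inner_weyl_weyl_smul, inner_weyl_left, smul_neg, Complex.conj_ofReal]
    ring
  simp only [hval, gaussianChar_smul, ← Complex.exp_add] at hlim
  have l1 := tendsto_exp_quadratic (Complex.I * (m ⬝ᵥ (w - v) : ℝ))
    (Complex.I * κ + -(1 / 4 : ℂ) * ((w - v) ⬝ᵥ A.mulVec (w - v) : ℝ))
  have l2 := tendsto_exp_quadratic (Complex.I * (m ⬝ᵥ (-v) : ℝ))
    (-(1 / 4 : ℂ) * ((-v) ⬝ᵥ A.mulVec (-v) : ℝ))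
  have l3 := tendsto_exp_quadratic (Complex.I * (m ⬝ᵥ w : ℝ))
    (-(1 / 4 : ℂ) * (w ⬝ᵥ A.mulVec w : ℝ))
  -- The first-order terms cancel, because `m · (w - v) = m · (-v) + m · w`.
  have h := tendsto_nhds_unique hlim (((l1.sub l2).sub l3).congr fun t => by
    have e : (Complex.I * κ + -(1 / 4 : ℂ) * ((w - v) ⬝ᵥ A.mulVec (w - v) : ℝ)) * (t : ℂ) ^ 2
      = Complex.I * κ * (t : ℂ) ^ 2
        + -(1 / 4 : ℂ) * ((w - v) ⬝ᵥ A.mulVec (w - v) : ℝ) * (t : ℂ) ^ 2 := by ring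
    have e2 : (m ⬝ᵥ (w - v) : ℝ) = m ⬝ᵥ (-v) + m ⬝ᵥ w := by
      rw [← dotProduct_add, neg_add_eq_sub]
    rw [e, add_left_comm, e2]
    push_cast
    ring)
  simp only [inner_smul_right, inner_smul_left, Complex.conj_I] at h
  have e : ∀ z : ℂ, Complex.I * (-Complex.I * z) = z := fun z => by
    rw [← mul_assoc, mul_neg, Complex.I_mul_I, neg_neg, one_mul]
  simp only [e] at h
  rw [h]
  have hm : m ⬝ᵥ (w - v) = m k - m j := by
    rw [dotProduct_sub, hv, hw, dotProduct_single, dotProduct_single, mul_one, mul_one]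
  have hs : ∀ a b : QuadIndex n, (Pi.single a 1 : QuadIndex n → ℝ) ⬝ᵥ A.mulVec (Pi.single b 1)
      = A a b := fun a b => by
    rw [single_one_dotProduct, Matrix.mulVec_single_one, Matrix.col_apply]
  have hA : (w - v) ⬝ᵥ A.mulVec (w - v) = A k k - A j k - A k j + A j j := by
    rw [Matrix.mulVec_sub, dotProduct_sub, sub_dotProduct, sub_dotProduct, hv, hw, hs, hs, hs, hs]
    ring
  have hAj : (-v) ⬝ᵥ A.mulVec (-v) = A j j := by
    rw [Matrix.mulVec_neg, neg_dotProduct_neg, hv, hs]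
  have hAk : w ⬝ᵥ A.mulVec w = A k k := by
    rw [hw, hs]
  have hmj : m ⬝ᵥ (-v) = - m j := by rw [dotProduct_neg, hv]; simp
  have hmk : m ⬝ᵥ w = m k := by rw [hw]; simp
  rw [hm, hA, hAj, hAk, hmj, hmk]
  push_cast
  ring_nf
  rw [Complex.I_sq]
  ring

end Family


/-- Centring removes the product of the means from the second moments, and the anticommutator
doubles the symmetric part `(A j k + A k j) / 4`. -/
theorem covarianceMatrix_eq {ρ : ModeSpace n →L[ℂ] ModeSpace n}
    {m : QuadIndex n → ℝ} {A V : Matrix (QuadIndex n) (QuadIndex n) ℝ} (hA : A.IsSymm)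
    (hρ : IsDensityOperator ρ)
    (hχ : ∀ ξ, HasTrace (ρ ∘L (weyl ξ).toContinuousLinearMap) (gaussianChar m A ξ))
    (hV : IsCovarianceMatrix ρ V) : V = A := by
  obtain ⟨s, ⟨hdom, hs⟩, hV⟩ := hV
  obtain ⟨u, b, -⟩ := exists_hilbertBasis ℂ (ModeSpace n)
  set ψ : u → ModeSpace n := fun i => opSqrt ρ (b i) with hψ
  have hχ' : ∀ ξ, HasSum (fun i => ⟪ψ i, weyl ξ (ψ i)⟫_ℂ) (gaussianChar m A ξ) := fun ξ =>
    hasSum_inner_opSqrt hρ.isPositive b (hρ.hasTrace_one u b) (weyl ξ).toContinuousLinearMap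
      (hχ ξ u b)
  have hdom' : ∀ j i, ψ i ∈ quadDomain j := fun j i => hdom j (b i)
  have hn := summable_norm_sq hχ'
  -- The diagonal entry `V j j` is a sum of `2 ‖(x̂ⱼ - sⱼ) ψᵢ‖²`, so its convergence gives the
  -- square-summability needed for domination.
  have hc : ∀ j, Summable fun i => ‖centredQuad s j (ψ i)‖ ^ 2 := fun j => by
    have h : ∀ φ : ModeSpace n, (⟪φ, φ⟫_ℂ + ⟪φ, φ⟫_ℂ).re / 2 = ‖φ‖ ^ 2 := fun φ => by
      rw [Complex.add_re, add_self_div_two, inner_self_eq_norm_sq_to_K]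
      norm_cast
    refine ((Complex.hasSum_re (hV j j u b)).summable.div_const 2).congr fun i => ?_
    exact h _
  have hq : ∀ j, Summable fun i => ‖quad j (ψ i)‖ ^ 2 := fun j => by
    refine Summable.of_nonneg_of_le (fun i => by positivity) (fun i => ?_)
      (((hc j).mul_left 2).add (hn.mul_left (2 * s j ^ 2)))
    have e : quad j (ψ i) = centredQuad s j (ψ i) + (s j : ℂ) • ψ i := by
      rw [centredQuad, sub_add_cancel]
    have h1 : ‖quad j (ψ i)‖ ≤ ‖centredQuad s j (ψ i)‖ + |s j| * ‖ψ i‖ := by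
      rw [e]
      refine (norm_add_le _ _).trans_eq ?_
      rw [norm_smul, Complex.norm_real, Real.norm_eq_abs]
    calc ‖quad j (ψ i)‖ ^ 2 ≤ (‖centredQuad s j (ψ i)‖ + |s j| * ‖ψ i‖) ^ 2 :=
          pow_le_pow_left₀ (norm_nonneg _) h1 2
      _ ≤ 2 * (‖centredQuad s j (ψ i)‖ ^ 2 + (|s j| * ‖ψ i‖) ^ 2) := add_sq_le
      _ = _ := by rw [mul_pow, sq_abs]; ring
  have hm : ∀ j, s j = m j := fun j => by
    have h := (hs j u b).tsum_eq
    rw [tsum_inner_quad j (hdom' j) hχ' (hq j)] at h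
    exact_mod_cast h.symm
  have hqq : ∀ j k, HasSum (fun i => ⟪quad j (ψ i), quad k (ψ i)⟫_ℂ)
      (Complex.I * ((symplecticForm (-Pi.single j 1) (Pi.single k 1) / 2 : ℝ) : ℂ)
        + m j * m k + (A j k + A k j) / 4) := fun j k => by
    rw [← tsum_inner_quad_quad j k (hdom' j) (hdom' k) hχ' (hq j) (hq k)]
    refine (Summable.of_norm_bounded (summable_norm_mul_norm (hq j) (hq k)) fun i => ?_).hasSum
    exact norm_inner_le_norm _ _
  have hmean : ∀ j, HasSum (fun i => ⟪ψ i, quad j (ψ i)⟫_ℂ) (m j : ℂ) := fun j => by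
    have h := hs j u b
    rwa [hm j] at h
  have hmean' : ∀ j, HasSum (fun i => ⟪quad j (ψ i), ψ i⟫_ℂ) (m j : ℂ) := fun j => by
    have h := Complex.hasSum_conj'.mpr (hmean j)
    simpa using h
  have hcc : ∀ j k, HasSum (fun i => ⟪centredQuad s j (ψ i), centredQuad s k (ψ i)⟫_ℂ)
      (Complex.I * ((symplecticForm (-Pi.single j 1) (Pi.single k 1) / 2 : ℝ) : ℂ)
        + (A j k + A k j) / 4) := fun j k => by
    have h := (((hqq j k).sub ((hmean' j).mul_left (s k : ℂ))).sub
      ((hmean k).mul_left (s j : ℂ))).add ((hasSum_inner_self hχ').mul_left ((s j : ℂ) * s k))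
    have e : (fun i => ⟪centredQuad s j (ψ i), centredQuad s k (ψ i)⟫_ℂ) = fun i =>
        ⟪quad j (ψ i), quad k (ψ i)⟫_ℂ - s k * ⟪quad j (ψ i), ψ i⟫_ℂ
          - s j * ⟪ψ i, quad k (ψ i)⟫_ℂ + s j * s k * ⟪ψ i, ψ i⟫_ℂ := by
      funext i
      simp only [centredQuad, inner_sub_left, inner_sub_right, inner_smul_left, inner_smul_right,
        Complex.conj_ofReal]
      ring
    rw [e]
    have e2 : Complex.I * ((symplecticForm (-Pi.single j 1) (Pi.single k 1) / 2 : ℝ) : ℂ)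
          + (A j k + A k j) / 4 = Complex.I * ((symplecticForm (-Pi.single j 1) (Pi.single k 1) / 2 : ℝ) : ℂ)
          + m j * m k + (A j k + A k j) / 4 - s k * m j - s j * m k + s j * s k * 1 := by
      rw [hm j, hm k]; ring
    rw [e2]
    exact h
  ext j k
  have h := (hV j k u b).unique ((hcc j k).add (hcc k j))
  -- Taking real parts discards the commutator terms.
  have hre := congrArg Complex.re h
  have hAjk : A k j = A j k := hA.apply j k
  rw [hAjk] at hre
  have e4 : ∀ x : ℝ, ((x : ℂ) + x) / 4 = ((x / 2 : ℝ) : ℂ) := fun x => by push_cast; ring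
  rw [e4] at hre
  simp only [Complex.add_re, Complex.I_mul_re, Complex.ofReal_im, Complex.ofReal_re] at hre
  linarith

/-! ### Trigonometric polynomials of a quadrature -/

/-- The one-parameter group `t ↦ exp (i t wᵀ x̂)` as a monoid homomorphism. -/
def weylHom (w : QuadIndex n → ℝ) : Multiplicative ℝ →* (ModeSpace n →L[ℂ] ModeSpace n) where
  toFun t := (weyl (t.toAdd • w)).toContinuousLinearMap
  map_one' := by
    ext1 ψ
    change weyl ((0 : ℝ) • w) ψ = ψ
    rw [zero_smul, weyl_zero]
  map_mul' s t := by
    ext1 ψ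
    exact (weyl_smul_add s.toAdd t.toAdd w ψ).symm

/-- The characters `t ↦ exp (i t x)` of the real line as monoid homomorphisms. -/
def expHom (x : ℝ) : Multiplicative ℝ →* ℂ where
  toFun t := Complex.exp (t.toAdd * x * Complex.I)
  map_one' := by simp
  map_mul' s t := by rw [← Complex.exp_add, toAdd_mul]; push_cast; ring_nf

/-- The trigonometric polynomial `x ↦ (∑ c_t exp (i t x))` evaluated at `wᵀ x̂`. -/
def trigOp (w : QuadIndex n → ℝ) :
    MonoidAlgebra ℂ (Multiplicative ℝ) →ₐ[ℂ] (ModeSpace n →L[ℂ] ModeSpace n) :=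
  MonoidAlgebra.lift ℂ _ _ (weylHom w)

/-- The trigonometric polynomial `x ↦ (∑ c_t exp (i t x))` evaluated at a real number. -/
def trigEval (x : ℝ) : MonoidAlgebra ℂ (Multiplicative ℝ) →ₐ[ℂ] ℂ :=
  MonoidAlgebra.lift ℂ _ _ (expHom x)

theorem trigOp_single (w : QuadIndex n → ℝ) (t : ℝ) (c : ℂ) :
    trigOp w (MonoidAlgebra.single (Multiplicative.ofAdd t) c) =
      c • (weyl (t • w)).toContinuousLinearMap :=
  MonoidAlgebra.lift_single _ _ _

theorem trigEval_single (x t : ℝ) (c : ℂ) :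
    trigEval x (MonoidAlgebra.single (Multiplicative.ofAdd t) c) =
      c * Complex.exp (t * x * Complex.I) :=
  MonoidAlgebra.lift_single _ _ _

theorem integrable_trigEval (μ : Measure ℝ) [IsProbabilityMeasure μ]
    (p : MonoidAlgebra ℂ (Multiplicative ℝ)) : Integrable (fun x => trigEval x p) μ := by
  induction p using MonoidAlgebra.induction_linear with
  | zero => simp
  | add p q hp hq =>
    simp only [map_add]
    exact hp.add hq
  | single t c =>
    have e : (fun x => trigEval x (MonoidAlgebra.single t c)) =
        fun x : ℝ => c * Complex.exp (t.toAdd * x * Complex.I) := by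
      funext x; exact trigEval_single x t.toAdd c
    rw [e]
    refine Integrable.const_mul ?_ c
    refine (integrable_const (1 : ℝ)).mono' (by fun_prop) (Eventually.of_forall fun x => ?_)
    rw [← Complex.ofReal_mul, Complex.norm_exp_ofReal_mul_I]

/-- If the characteristic function of `wᵀ x̂` in `ρ` is that of a probability measure `μ`, then
the expectation of every trigonometric polynomial in `wᵀ x̂` is its integral against `μ`. -/
theorem hasSum_inner_trigOp {ρ : ModeSpace n →L[ℂ] ModeSpace n} {w : QuadIndex n → ℝ}
    {μ : Measure ℝ} [IsProbabilityMeasure μ]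
    {ι : Type} (b : HilbertBasis ι ℂ (ModeSpace n))
    (h : ∀ t : ℝ, HasSum (fun i => ⟪b i, ρ (weyl (t • w) (b i))⟫_ℂ) (charFun μ t))
    (p : MonoidAlgebra ℂ (Multiplicative ℝ)) :
    HasSum (fun i => ⟪b i, ρ (trigOp w p (b i))⟫_ℂ) (∫ x, trigEval x p ∂μ) := by
  induction p using MonoidAlgebra.induction_linear with
  | zero => simp
  | add p q hp hq =>
    simp only [map_add, add_apply, inner_add_right]
    rw [integral_add (integrable_trigEval μ p) (integrable_trigEval μ q)]
    exact hp.add hq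
  | single t c =>
    have e : (fun x => trigEval x (MonoidAlgebra.single t c)) =
        fun x : ℝ => c * Complex.exp (t.toAdd * x * Complex.I) := by
      funext x; exact trigEval_single x t.toAdd c
    have e2 : trigOp w (MonoidAlgebra.single t c) =
      c • (weyl (t.toAdd • w)).toContinuousLinearMap := trigOp_single w t.toAdd c
    rw [e, e2, integral_const_mul, ← charFun_apply_real]
    simp only [smul_apply, map_smul, inner_smul_right]
    exact (h t.toAdd).mul_left c

/-- `Tr (T F²) ≥ 0` for positive `T` and self-adjoint `F`. -/
theorem nonneg_of_hasSum_inner_sq {H ι : Type} [NormedAddCommGroup H] [InnerProductSpace ℂ H]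
    [CompleteSpace H] {T F : H →L[ℂ] H} (hT : T.IsPositive) (hF : IsSelfAdjoint F)
    (b : HilbertBasis ι ℂ H) {τ₀ τ : ℂ} (h₀ : HasSum (fun i => ⟪b i, T (b i)⟫_ℂ) τ₀)
    (h : HasSum (fun i => ⟪b i, T ((F * F) (b i))⟫_ℂ) τ) : 0 ≤ τ.re := by
  have h1 := Complex.hasSum_re (hasSum_inner_opSqrt hT b h₀ (F * F) h)
  refine h1.nonneg fun i => ?_
  have hF' : F.adjoint = F := hF
  change 0 ≤ (⟪opSqrt T (b i), F (F (opSqrt T (b i)))⟫_ℂ).re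
  rw [← ContinuousLinearMap.adjoint_inner_left, hF']
  exact inner_self_nonneg (𝕜 := ℂ)

/-- The element of the group algebra representing `x ↦ 1 + l sin (t x)`. -/
def sinPoly (l t : ℝ) : MonoidAlgebra ℂ (Multiplicative ℝ) :=
  1 + ((l / 2 : ℝ) * -Complex.I : ℂ) • (MonoidAlgebra.single (Multiplicative.ofAdd t) 1
    - MonoidAlgebra.single (Multiplicative.ofAdd (-t)) 1)

theorem trigEval_sinPoly (x l t : ℝ) : trigEval x (sinPoly l t) = (1 + l * Real.sin (t * x) : ℝ) := by
  rw [sinPoly, map_add, map_smul, map_sub, map_one, trigEval_single, trigEval_single]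
  push_cast
  rw [Complex.sin, smul_eq_mul, neg_mul]
  ring

theorem adjoint_weyl (ξ : QuadIndex n → ℝ) :
    star (weyl ξ).toContinuousLinearMap = (weyl (-ξ)).toContinuousLinearMap := by
  refine ((ContinuousLinearMap.eq_adjoint_iff _ _).mpr fun x y => ?_).symm
  have h := inner_weyl_left (-ξ) x y
  rwa [neg_neg] at h

/-- The adjoint swaps the Weyl operators at `t` and `-t`; this sign is undone by conjugating the
imaginary coefficient. -/
theorem isSelfAdjoint_trigOp_sinPoly (w : QuadIndex n → ℝ) (l t : ℝ) :
    IsSelfAdjoint (trigOp w (sinPoly l t)) := by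
  rw [sinPoly, map_add, map_smul, map_sub, map_one, trigOp_single, trigOp_single, one_smul,
    one_smul, neg_smul, IsSelfAdjoint, star_add, star_one, star_smul, star_sub, adjoint_weyl,
    adjoint_weyl, neg_neg]
  congr 1
  simp only [mul_neg, star_neg, star_mul', Complex.star_def, Complex.conj_ofReal, Complex.conj_I,
    neg_neg, neg_smul]
  module

/-- This is `Tr ((c σ - ρ) F²) ≥ 0` for `F` the trigonometric polynomial `(1 + l sin (t x))^N`
evaluated at `wᵀ x̂`. -/
theorem integral_pow_le {ρ σ : ModeSpace n →L[ℂ] ModeSpace n} (hρ : IsDensityOperator ρ)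
    (hσ : IsDensityOperator σ) {c : ℝ} (hle : ρ ≤ (c : ℂ) • σ) (w : QuadIndex n → ℝ)
    {μ ν : Measure ℝ} [IsProbabilityMeasure μ] [IsProbabilityMeasure ν]
    (hμ : ∀ t : ℝ, HasTrace (ρ ∘L (weyl (t • w)).toContinuousLinearMap) (charFun μ t))
    (hν : ∀ t : ℝ, HasTrace (σ ∘L (weyl (t • w)).toContinuousLinearMap) (charFun ν t))
    (l t : ℝ) (N : ℕ) :
    ∫ x, ((1 + l * Real.sin (t * x)) ^ N) ^ 2 ∂μ ≤ c * ∫ x, ((1 + l * Real.sin (t * x)) ^ N) ^ 2 ∂ν := by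
  obtain ⟨u, b, -⟩ := exists_hilbertBasis ℂ (ModeSpace n)
  set F := trigOp w (sinPoly l t ^ N) with hF
  have hFs : IsSelfAdjoint F := by
    rw [hF, map_pow]; exact (isSelfAdjoint_trigOp_sinPoly w l t).pow N
  have hpos : ((c : ℂ) • σ - ρ).IsPositive := by
    rwa [ContinuousLinearMap.le_def] at hle
  have e : ∀ κ : Measure ℝ, ∫ x, trigEval x (sinPoly l t ^ N * sinPoly l t ^ N) ∂κ
      = ((∫ x, ((1 + l * Real.sin (t * x)) ^ N) ^ 2 ∂κ : ℝ) : ℂ) := fun κ => by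
    rw [← integral_complex_ofReal]
    refine integral_congr_ae (Eventually.of_forall fun x => ?_)
    simp only [map_mul, map_pow, trigEval_sinPoly]
    push_cast; ring
  have h1 := hasSum_inner_trigOp b (fun t => hμ t u b) (sinPoly l t ^ N * sinPoly l t ^ N)
  have h2 := hasSum_inner_trigOp b (fun t => hν t u b) (sinPoly l t ^ N * sinPoly l t ^ N)
  rw [e, map_mul, ← hF] at h1 h2
  have h3 := (h2.mul_left (c : ℂ)).sub h1
  have h0 := ((hσ.hasTrace_one u b).mul_left (c : ℂ)).sub (hρ.hasTrace_one u b)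
  have h4 := nonneg_of_hasSum_inner_sq (T := (c : ℂ) • σ - ρ) hpos hFs b
    (by simpa only [sub_apply, smul_apply, inner_sub_right,
      inner_smul_right] using h0)
    (by simpa only [sub_apply, smul_apply, inner_sub_right,
      inner_smul_right] using h3)
  rw [← Complex.ofReal_mul, ← Complex.ofReal_sub, Complex.ofReal_re] at h4
  linarith

/-! ### Passage to moment generating functions -/

theorem tendsto_one_add_sin_pow (l x : ℝ) :
    Tendsto (fun N : ℕ => (1 + l * Real.sin ((N : ℝ)⁻¹ * x)) ^ N) atTop (𝓝 (Real.exp (l * x))) := by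
  refine Real.tendsto_one_add_pow_exp_of_tendsto ?_
  have h0 : HasDerivAt (fun s : ℝ => l * Real.sin (s * x)) (l * x) 0 := by
    have := (((hasDerivAt_id (0 : ℝ)).mul_const x).sin).const_mul l
    simpa using this
  have h1 := h0.tendsto_slope_zero
  have h2 : Tendsto (fun N : ℕ => (N : ℝ)⁻¹) atTop (𝓝[≠] 0) := by
    refine tendsto_nhdsWithin_iff.mpr ⟨tendsto_inv_atTop_nhds_zero_nat, ?_⟩
    filter_upwards [eventually_ne_atTop 0] with N hN
    simpa using hN
  refine (h1.comp h2).congr fun N => ?_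
  simp

/-- From `|sin y| ≤ |y|` and `1 + y ≤ exp y`. The bound does not depend on `N`, as dominated
convergence requires. -/
theorem abs_one_add_sin_pow_le (l x : ℝ) (N : ℕ) :
    |(1 + l * Real.sin ((N : ℝ)⁻¹ * x)) ^ N| ≤ Real.exp (|l * x|) := by
  rcases Nat.eq_zero_or_pos N with rfl | hN
  · simp [mul_nonneg]
  · have hN' : (0 : ℝ) < N := by exact_mod_cast hN
    have h1 : |1 + l * Real.sin ((N : ℝ)⁻¹ * x)| ≤ Real.exp (|l * x| / N) := by
      calc |1 + l * Real.sin ((N : ℝ)⁻¹ * x)| ≤ |1| + |l * Real.sin ((N : ℝ)⁻¹ * x)| := abs_add_le _ _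
        _ ≤ 1 + |l * x| / N := by
          rw [abs_one, abs_mul, abs_mul]
          have := Real.abs_sin_le_abs (x := (N : ℝ)⁻¹ * x)
          rw [abs_mul, abs_inv, abs_of_pos hN'] at this
          rw [mul_div_assoc, div_eq_inv_mul]
          gcongr
        _ ≤ Real.exp (|l * x| / N) := by rw [add_comm]; exact Real.add_one_le_exp _
    rw [abs_pow]
    refine (pow_le_pow_left₀ (abs_nonneg _) h1 N).trans_eq ?_
    rw [← Real.exp_nat_mul]
    congr 1
    field_simp

theorem tendsto_integral_one_add_sin_pow (l μ : ℝ) (v : NNReal) :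
    Tendsto (fun N : ℕ => ∫ x, ((1 + l * Real.sin ((N : ℝ)⁻¹ * x)) ^ N) ^ 2 ∂(gaussianReal μ v)) atTop
      (𝓝 (Real.exp (μ * (2 * l) + v * (2 * l) ^ 2 / 2))) := by
  have hmgf : ∫ x, Real.exp (2 * l * x) ∂(gaussianReal μ v)
      = Real.exp (μ * (2 * l) + v * (2 * l) ^ 2 / 2) :=
    congrFun (mgf_fun_id_gaussianReal (μ := μ) (v := v)) (2 * l)
  rw [← hmgf]
  refine tendsto_integral_of_dominated_convergence
    -- This sum dominates `exp (2 |l x|)` and is integrable, being made of Gaussian exponential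
    -- moments.
    (fun x => Real.exp (2 * l * x) + Real.exp (-(2 * l) * x)) (fun N => ?_) ?_ (fun N => ?_) ?_
  · exact Continuous.aestronglyMeasurable (by fun_prop)
  · exact (integrable_exp_mul_gaussianReal _).add (integrable_exp_mul_gaussianReal _)
  · refine Eventually.of_forall fun x => ?_
    rw [norm_pow, Real.norm_eq_abs]
    refine (pow_le_pow_left₀ (abs_nonneg _) (abs_one_add_sin_pow_le l x N) 2).trans ?_
    rw [← Real.exp_nat_mul]
    rcases abs_cases (l * x) with ⟨h, -⟩ | ⟨h, -⟩
    · rw [h]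
      refine le_add_of_le_of_nonneg (le_of_eq ?_) (Real.exp_pos _).le
      push_cast; ring_nf
    · rw [h]
      refine le_add_of_nonneg_of_le (Real.exp_pos _).le (le_of_eq ?_)
      push_cast; ring_nf
  · refine Eventually.of_forall fun x => ?_
    have h := (tendsto_one_add_sin_pow l x).pow 2
    rw [← Real.exp_nat_mul] at h
    convert h using 3
    push_cast; ring

/-- If `exp (p l + a l²) ≤ c exp (q l + b l²)` for all `l`, then `a ≤ b`. -/
theorem le_of_exp_quadratic_le {a b p q c : ℝ}
    (h : ∀ l : ℝ, Real.exp (p * l + a * l ^ 2) ≤ c * Real.exp (q * l + b * l ^ 2)) : a ≤ b := by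
  by_contra! hab
  have hc : 1 ≤ c := by simpa using h 0
  have hd : 0 < a - b := sub_pos.mpr hab
  -- Chosen so that `l ≥ 1` and `(a - b) l ≥ |p - q| + c`. The exponent difference is then at least
  -- `c`, while its exponential is at most `c`, contradicting `x + 1 ≤ exp x`.
  set l : ℝ := (|p - q| + c) / (a - b) + 1 with hl
  have hl1 : 1 ≤ l := by
    have : 0 ≤ (|p - q| + c) / (a - b) := by positivity
    linarith
  have hlarge : |p - q| + c ≤ (a - b) * l := by
    rw [hl, mul_add, mul_div_cancel₀ _ hd.ne']; linarith
  have h1 := h l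
  have h2 : Real.exp ((p - q) * l + (a - b) * l ^ 2) ≤ c := by
    rw [← div_le_iff₀ (Real.exp_pos _), ← Real.exp_sub] at h1
    have e : (p - q) * l + (a - b) * l ^ 2 = p * l + a * l ^ 2 - (q * l + b * l ^ 2) := by ring
    rwa [e]
  have h3 : c ≤ (p - q) * l + (a - b) * l ^ 2 := by
    have h4 : c ≤ (p - q) + (a - b) * l := by linarith [neg_abs_le (p - q)]
    nlinarith
  have h5 := Real.add_one_le_exp ((p - q) * l + (a - b) * l ^ 2)
  linarith

/-! ### Comparison of the covariance matrices -/

theorem exists_le_smul_of_maxRelEntropy_lt_top {ρ σ : ModeSpace n →L[ℂ] ModeSpace n}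
    (h : maxRelEntropy ρ σ < ⊤) : ∃ c : ℝ, ρ ≤ (c : ℂ) • σ := by
  obtain ⟨x, ⟨r, -, hr⟩, -⟩ := sInf_lt_iff.mp h
  exact ⟨Real.exp r, hr⟩

theorem norm_gaussianChar (m : QuadIndex n → ℝ) (A : Matrix (QuadIndex n) (QuadIndex n) ℝ)
    (ξ : QuadIndex n → ℝ) : ‖gaussianChar m A ξ‖ = Real.exp (-(1 / 4) * (ξ ⬝ᵥ A.mulVec ξ)) := by
  rw [gaussianChar, Complex.norm_exp]
  congr 1
  have e : (1 / 4 : ℂ) * (ξ ⬝ᵥ A.mulVec ξ : ℝ) = ((1 / 4 * (ξ ⬝ᵥ A.mulVec ξ) : ℝ) : ℂ) := by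
    push_cast; ring
  rw [e, Complex.sub_re, Complex.I_mul_re, Complex.ofReal_im, Complex.ofReal_re]
  ring

/-- Weyl operators are isometric and the trace is one, so the characteristic function is bounded by
`1`. This makes `wᵀ A w / 2` a legitimate variance. -/
theorem dotProduct_mulVec_nonneg {ρ : ModeSpace n →L[ℂ] ModeSpace n}
    {m : QuadIndex n → ℝ} {A : Matrix (QuadIndex n) (QuadIndex n) ℝ} (hρ : IsDensityOperator ρ)
    (hχ : ∀ ξ, HasTrace (ρ ∘L (weyl ξ).toContinuousLinearMap) (gaussianChar m A ξ))
    (ξ : QuadIndex n → ℝ) : 0 ≤ ξ ⬝ᵥ A.mulVec ξ := by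
  obtain ⟨u, b, -⟩ := exists_hilbertBasis ℂ (ModeSpace n)
  have h1 := hasSum_inner_opSqrt hρ.isPositive b (hρ.hasTrace_one u b)
    (weyl ξ).toContinuousLinearMap (hχ ξ u b)
  have h2 := hasSum_norm_opSqrt_sq hρ.isPositive b (hρ.hasTrace_one u b)
  have h3 : ‖gaussianChar m A ξ‖ ≤ 1 := by
    rw [← h1.tsum_eq]
    refine tsum_of_norm_bounded h2 fun i => (norm_inner_le_norm _ _).trans_eq ?_
    rw [LinearIsometry.coe_toContinuousLinearMap, LinearIsometry.norm_map, sq]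
  rw [norm_gaussianChar, Real.exp_le_one_iff] at h3
  linarith

/-- The variance is `wᵀ A w / 2` because a real Gaussian of variance `v` carries `-v t² / 2` in the
exponent, here `-t² wᵀ A w / 4`. -/
theorem charFun_gaussianReal_eq_gaussianChar (m : QuadIndex n → ℝ)
    (A : Matrix (QuadIndex n) (QuadIndex n) ℝ) {w : QuadIndex n → ℝ}
    (hw : 0 ≤ w ⬝ᵥ A.mulVec w) (t : ℝ) :
    charFun (gaussianReal (m ⬝ᵥ w) (w ⬝ᵥ A.mulVec w / 2).toNNReal) t
      = gaussianChar m A (t • w) := by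
  have e : (((w ⬝ᵥ A.mulVec w / 2).toNNReal : ℝ) : ℂ) = ((w ⬝ᵥ A.mulVec w / 2 : ℝ) : ℂ) := by
    rw [Real.coe_toNNReal _ (by positivity)]
  rw [charFun_gaussianReal, gaussianChar_smul, e]
  congr 1
  push_cast
  ring

/-- Domination `ρ ≤ c σ` of Gaussian states forces domination of the quadratic forms in the
exponents of their characteristic functions. -/
theorem dotProduct_mulVec_le {ρ σ : ModeSpace n →L[ℂ] ModeSpace n} {m₁ m₂ : QuadIndex n → ℝ}
    {A₁ A₂ : Matrix (QuadIndex n) (QuadIndex n) ℝ} (hρ : IsDensityOperator ρ)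
    (hσ : IsDensityOperator σ)
    (hχ₁ : ∀ ξ, HasTrace (ρ ∘L (weyl ξ).toContinuousLinearMap) (gaussianChar m₁ A₁ ξ))
    (hχ₂ : ∀ ξ, HasTrace (σ ∘L (weyl ξ).toContinuousLinearMap) (gaussianChar m₂ A₂ ξ))
    {c : ℝ} (hle : ρ ≤ (c : ℂ) • σ) (w : QuadIndex n → ℝ) :
    w ⬝ᵥ A₁.mulVec w ≤ w ⬝ᵥ A₂.mulVec w := by
  have h₁ := dotProduct_mulVec_nonneg hρ hχ₁ w
  have h₂ := dotProduct_mulVec_nonneg hσ hχ₂ w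
  have hmgf : ∀ l : ℝ, Real.exp (m₁ ⬝ᵥ w * (2 * l)
        + (w ⬝ᵥ A₁.mulVec w / 2).toNNReal * (2 * l) ^ 2 / 2)
      ≤ c * Real.exp (m₂ ⬝ᵥ w * (2 * l)
        + (w ⬝ᵥ A₂.mulVec w / 2).toNNReal * (2 * l) ^ 2 / 2) := fun l =>
    -- `integral_pow_le` is used with `t = 1 / N`; the square in it puts the moment generating
    -- functions at `2 l`.
    le_of_tendsto_of_tendsto' (tendsto_integral_one_add_sin_pow l _ _)
      ((tendsto_integral_one_add_sin_pow l _ _).const_mul c) fun N =>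
        integral_pow_le hρ hσ hle w
          (fun t => by rw [charFun_gaussianReal_eq_gaussianChar m₁ A₁ h₁]; exact hχ₁ _)
          (fun t => by rw [charFun_gaussianReal_eq_gaussianChar m₂ A₂ h₂]; exact hχ₂ _) l _ N
  refine le_of_exp_quadratic_le (p := 2 * (m₁ ⬝ᵥ w)) (q := 2 * (m₂ ⬝ᵥ w)) (c := c) fun l => ?_
  have h := hmgf l
  rw [Real.coe_toNNReal _ (by positivity), Real.coe_toNNReal _ (by positivity)] at h
  convert h using 2
  · ring
  · congr 1; ring

end GaussianQuantum

end

theorem mainTheorem6 (n : ℕ)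
    (ρ σ : GaussianQuantum.ModeSpace n →L[ℂ] GaussianQuantum.ModeSpace n)
    (hρ : GaussianQuantum.IsGaussianState ρ) (hσ : GaussianQuantum.IsGaussianState σ)
    (Vρ Vσ : Matrix (GaussianQuantum.QuadIndex n) (GaussianQuantum.QuadIndex n) ℝ)
    (hVρ : GaussianQuantum.IsCovarianceMatrix ρ Vρ)
    (hVσ : GaussianQuantum.IsCovarianceMatrix σ Vσ)
    (hD : GaussianQuantum.maxRelEntropy ρ σ < ⊤) :
    (Vσ - Vρ).PosSemidef := by
  obtain ⟨m₁, A₁, hA₁, hχ₁⟩ := hρ.gaussian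
  obtain ⟨m₂, A₂, hA₂, hχ₂⟩ := hσ.gaussian
  obtain ⟨c, hc⟩ := GaussianQuantum.exists_le_smul_of_maxRelEntropy_lt_top hD
  obtain rfl := GaussianQuantum.covarianceMatrix_eq hA₁ hρ.toIsDensityOperator hχ₁ hVρ
  obtain rfl := GaussianQuantum.covarianceMatrix_eq hA₂ hσ.toIsDensityOperator hχ₂ hVσ
  refine Matrix.PosSemidef.of_dotProduct_mulVec_nonneg ?_ fun w => ?_
  · exact (Matrix.conjTranspose_eq_transpose_of_trivial _).trans (hA₂.sub hA₁)
  · rw [star_trivial, Matrix.sub_mulVec, dotProduct_sub, sub_nonneg]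
    exact GaussianQuantum.dotProduct_mulVec_le hρ.toIsDensityOperator hσ.toIsDensityOperator
      hχ₁ hχ₂ hc w
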